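/- A priority-based player-specific congestion game consists of a finite set $N$ of players, a finite set $E$ of resources, a family $\mathcal{S}_i \subseteq 2^E$ of strategies for each player $i \in N$, a priority function $p_e \colon N \to \mathbb{Z}_{>0}$ for each resource $e \in E$, and a delay function $d_{i,e} \colon \mathbb{Z}_{\ge 0} \times \mathbb{Z}_{>0} \to \mathbb{R}_{\ge 0}$ for each $i \in N$ and $e \in E$ such that $d_{i,e}(x,y) \le d_{i,e}(x',y)$ for $x < x'$, $d_{i,e}(x,y) \le d_{i,e}(x,y')$ for $y < y'$, and $d_{i,e}(x,y) \le d_{i,e}(x+y-1,1)$ for all $x \ge 0$, $y \ge 1$. In a strategy profile $S = (S_j)_{j \in N}$ with $S_j \in \mathcal{S}_j$, the cost of player $i$ is $$\gamma_i(S) = \sum_{e \in S_i} d_{i,e}\bigl(|\{j : e \in S_j,\ p_e(j) < p_e(i)\}|,\ |\{j : e \in S_j,\ p_e(j) = p_e(i)\}|\bigr).$$ A better response is a change of the strategy of a single player $i$ to another strategy in $\mathcal{S}_i$ that strictly decreases her cost $\gamma_i$; a pure Nash equilibrium is a strategy profile in which no player has a better response. The game has consistent priorities if all resources have the same priority function,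 and it is a matroid game if, for each player $i$, $\mathcal{S}_i$ is the family of bases of a matroid with ground set $E$. Theorem. There is a polynomial $P$ in two variables such that, for every priority-based player-specific matroid congestion game with consistent priorities and every strategy profile $S$ of it, there exists a sequence of at most $P(|N|,|E|)$ better responses that starts from $S$ and reaches a pure Nash equilibrium. -/

import Mathlib

universe u v

open scoped NNReal

/-- A priority-based player-specific congestion game with player set `N` and resource set `E`.

Every player has a family of strategies (sets of resources), every resource has a priority function
on the players with positive integer values (a smaller value means a higher priority), and
`delay i e x y` is the delay that resource `e` imposes on player `i` when `x` players of strictly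
higher priority than `i`, and `y` players of the same priority as `i` (including `i` herself), use
`e`. Only the values with `1 ≤ y` are meaningful and constrained. -/
structure PriorityCongestionGame (N : Type u) (E : Type v) where
  strategies : N → Set (Finset E)
  priority : E → N → ℕ+
  delay : N → E → ℕ → ℕ → ℝ≥0
  delay_mono_left : ∀ i e x x' y, 1 ≤ y → x < x' → delay i e x y ≤ delay i e x' y
  delay_mono_right : ∀ i e x y y', 1 ≤ y → y < y' → delay i e x y ≤ delay i e x y'
  delay_le_shift : ∀ i e x y, 1 ≤ y → delay i e x y ≤ delay i e (x + y - 1) 1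

namespace PriorityCongestionGame

variable {N : Type u} {E : Type v} (G : PriorityCongestionGame N E)

/-- All resources have the same priority function. -/
def Consistent : Prop :=
  ∃ p : N → ℕ+, ∀ e, G.priority e = p

/-- The strategy family of every player is the family of bases of a matroid on the set of all
resources. -/
def IsMatroidGame : Prop :=
  ∀ i, ∃ M : Matroid E, M.E = Set.univ ∧ ∀ T : Finset E, T ∈ G.strategies i ↔ M.IsBase (T : Set E)

/-- `S` is a strategy profile: every player uses one of her strategies. -/
def IsProfile (S : N → Finset E) : Prop :=
  ∀ i, S i ∈ G.strategies i

section Cost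

variable [Fintype N] [DecidableEq E]

/-- The number of users of `e` in `S` that `e` prioritizes strictly over `i`. -/
def numHigher (S : N → Finset E) (i : N) (e : E) : ℕ :=
  (Finset.univ.filter fun j => e ∈ S j ∧ G.priority e j < G.priority e i).card

/-- The number of users of `e` in `S` with the same priority as `i` at `e`. -/
def numEqual (S : N → Finset E) (i : N) (e : E) : ℕ :=
  (Finset.univ.filter fun j => e ∈ S j ∧ G.priority e j = G.priority e i).card

/-- The cost of player `i` in `S`: the total delay over the resources in her strategy. -/
def cost (S : N → Finset E) (i : N) : ℝ≥0 :=
  ∑ e ∈ S i, G.delay i e (G.numHigher S i e) (G.numEqual S i e)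

variable [DecidableEq N]

/-- `S'` arises from `S` by a better response of one player: she alone changes her strategy, and her
cost strictly decreases. -/
def IsBetterResponse (S S' : N → Finset E) : Prop :=
  ∃ i, ∃ T ∈ G.strategies i, S' = Function.update S i T ∧ G.cost S' i < G.cost S i

/-- `S` is a pure Nash equilibrium. -/
def IsPureNash (S : N → Finset E) : Prop :=
  G.IsProfile S ∧ ∀ i, ∀ T ∈ G.strategies i, G.cost S i ≤ G.cost (Function.update S i T) i

end Cost

end PriorityCongestionGame

/-! ### Exchange families and locally optimal bases -/

section Exchange

variable {E : Type v} [DecidableEq E]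

/-! With consistent priorities, a cost depends only on players of equal or higher priority. The
priority classes can therefore be settled from the top down: later moves never disturb earlier
classes, and each class plays a player-specific matroid congestion game with monotone delays
(`reach_class_equilibrium`).

Within a class, first let each player use only the resources of her initial strategy, which is
trivially an equilibrium, then release the pairs (player, resource) one at a time
(`reach_available`). A release enables at most one improving move, which leaves an excess user on
one resource and a hole on another. Keeping reference loads frozen, best exchanges move the excess
user until she fills the hole or nobody wants to leave; in the latter case, the reference loads
absorb her and best exchanges move the hole (`reach_of_excess`, `reach_of_hole`). Frozen loads give
fixed weights, so each phase lowers a sum of weight ranks, which is polynomially bounded. Best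
exchanges keep bases settled for these weights (`Settled.swap_of_raise`, `Settled.swap_of_lower`),
and settled bases are best responses by `Settled.sum_le_sum`. -/

/-- The set `B` with `a` replaced by `b`. -/
def swap (B : Finset E) (a b : E) : Finset E := insert b (B.erase a)

theorem mem_swap {B : Finset E} {a b c : E} : c ∈ swap B a b ↔ c = b ∨ c ≠ a ∧ c ∈ B := by
  simp [swap]

/-- The exchange property of the bases of a matroid, together with its dual. -/
structure IsExchangeFamily (F : Set (Finset E)) : Prop where
  exchange : ∀ A ∈ F, ∀ B ∈ F, ∀ a ∈ A, a ∉ B → ∃ b ∈ B, b ∉ A ∧ swap A a b ∈ F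
  rev_exchange : ∀ A ∈ F, ∀ B ∈ F, ∀ b ∈ B, b ∉ A → ∃ a ∈ A, a ∉ B ∧ swap A a b ∈ F

theorem IsExchangeFamily.restrict {F : Set (Finset E)} (hF : IsExchangeFamily F) (p : E → Prop) :
    IsExchangeFamily {B ∈ F | ∀ e ∈ B, p e} := by
  constructor
  · rintro A ⟨hA, hpA⟩ B ⟨hB, hpB⟩ a ha haB
    obtain ⟨b, hb, hbA, hs⟩ := hF.exchange A hA B hB a ha haB
    exact ⟨b, hb, hbA, hs, fun e he => (mem_swap.1 he).elim (fun h => h ▸ hpB b hb)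
      fun h => hpA e h.2⟩
  · rintro A ⟨hA, hpA⟩ B ⟨hB, hpB⟩ b hb hbA
    obtain ⟨a, ha, haB, hs⟩ := hF.rev_exchange A hA B hB b hb hbA
    exact ⟨a, ha, haB, hs, fun e he => (mem_swap.1 he).elim (fun h => h ▸ hpB b hb)
      fun h => hpA e h.2⟩

/-- This is ordinary exchange in the dual matroid, applied to the complements of `A` and `B`. -/
theorem Matroid.IsBase.rev_exchange {M : Matroid E} {A B : Set E} (hA : M.IsBase A)
    (hB : M.IsBase B) {b : E} (hb : b ∈ B \ A) : ∃ a ∈ A \ B, M.IsBase (insert b (A \ {a})) := by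
  have hbE : b ∈ M.E := hB.subset_ground hb.1
  obtain ⟨a, ha, h⟩ := hA.compl_isBase_dual.exchange hB.compl_isBase_dual (e := b)
    ⟨⟨hbE, hb.2⟩, fun h => h.2 hb.1⟩
  have haA : a ∈ A := by
    by_contra hc
    exact ha.2 ⟨ha.1.1, hc⟩
  refine ⟨a, ⟨haA, ha.1.2⟩, ?_⟩
  have h2 := h.compl_isBase_of_dual
  have hAE := hA.subset_ground
  convert h2 using 1
  ext c
  have := @hAE c
  simp only [Set.mem_insert_iff, Set.mem_sdiff, Set.mem_singleton_iff]
  by_cases hcb : c = b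
  · subst hcb
    have : c ≠ a := fun h => hb.2 (h ▸ haA)
    simp [this, hbE]
  · simp only [hcb]
    tauto

theorem Matroid.isExchangeFamily_bases (M : Matroid E) :
    IsExchangeFamily {B : Finset E | M.IsBase (B : Set E)} := by
  constructor
  · intro A hA B hB a ha haB
    obtain ⟨b, hb, h⟩ := Matroid.IsBase.exchange (M := M) hA hB (e := a) ⟨ha, haB⟩
    exact ⟨b, hb.1, hb.2, by simpa [swap] using h⟩
  · intro A hA B hB b hb hbA
    obtain ⟨a, ha, h⟩ := Matroid.IsBase.rev_exchange (M := M) hA hB (b := b) ⟨hb, hbA⟩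
    exact ⟨a, ha.1, ha.2, by simpa [swap] using h⟩

/-- No single exchange improves `B`, where the elements of `B` have weights `u` and the other
elements have weights `v`. -/
def Settled (F : Set (Finset E)) (u v : E → ℝ≥0) (B : Finset E) : Prop :=
  ∀ a ∈ B, ∀ b, b ∉ B → swap B a b ∈ F → u a ≤ v b

/-- Two consecutive exchanges can be replaced by one of the first kind, or by both crossed ones. -/
theorem IsExchangeFamily.swap_swap {F : Set (Finset E)} (hF : IsExchangeFamily F) {B : Finset E}
    (hB : B ∈ F) {f g a b : E} (hf : f ∈ B) (hg : g ∉ B) (ha : a ∈ B) (hb : b ∉ B) (haf : a ≠ f)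
    (hbg : b ≠ g) (h : swap (swap B f g) a b ∈ F) :
    swap B a b ∈ F ∨ swap B a g ∈ F ∧ swap B f b ∈ F := by
  by_cases hab : swap B a b ∈ F
  · exact Or.inl hab
  -- Exchanging with `B - f - a + g + b`: since `B - a + b` is excluded, `a` can only be replaced by
  -- `g`, and `b` can only replace `f`.
  refine Or.inr ⟨?_, ?_⟩
  · obtain ⟨y, hy, hyB, hs⟩ := hF.exchange B hB _ h a ha (by simp only [mem_swap]; grind)
    have : y = g := by
      simp only [mem_swap] at hy
      grind
    exact this ▸ hs
  · obtain ⟨y, hy, hyB, hs⟩ := hF.rev_exchange B hB _ h b (by simp [mem_swap]) hb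
    have : y = f := by
      simp only [mem_swap] at hyB
      grind
    exact this ▸ hs

theorem swap_swap_self_left {B : Finset E} {f g b : E} (hg : g ∉ B) :
    swap (swap B f g) g b = swap B f b := by
  ext c
  simp only [mem_swap]
  grind

theorem swap_swap_self_right {B : Finset E} {f g a : E} (hf : f ∈ B) (hg : g ∉ B) (haf : a ≠ f)
    (ha : a ∈ B) : swap (swap B f g) a f = swap B a g := by
  ext c
  simp only [mem_swap]
  grind

/-- After the weight of `f` has been raised, the best exchange for `f` settles the base again. -/
theorem Settled.swap_of_raise {F : Set (Finset E)} (hF : IsExchangeFamily F) {u v : E → ℝ≥0}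
    {B : Finset E} (hB : B ∈ F) (h : Settled F u v B) (huv : ∀ e, u e ≤ v e) {f g : E}
    (hf : f ∈ B) (hg : g ∉ B) (hgf : v g ≤ v f)
    (hmin : ∀ b, b ∉ B → swap B f b ∈ F → v g ≤ v b) (hfg : swap B f g ∈ F) :
    Settled F u v (swap B f g) := by
  intro a ha b hb hab
  by_cases hag : a = g
  · subst hag
    rw [swap_swap_self_left hg] at hab
    by_cases hbf : b = f
    · exact hbf ▸ (huv a).trans hgf
    · exact (huv a).trans (hmin b (fun hbB => hb (mem_swap.2 (Or.inr ⟨hbf, hbB⟩))) hab)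
  have haf : a ≠ f ∧ a ∈ B := (mem_swap.1 ha).resolve_left hag
  by_cases hbf : b = f
  · subst hbf
    rw [swap_swap_self_right hf hg haf.1 haf.2] at hab
    exact (h a haf.2 g hg hab).trans hgf
  have hbB : b ∉ B := fun hbB => hb (mem_swap.2 (Or.inr ⟨hbf, hbB⟩))
  have hbg : b ≠ g := fun hbg => hb (mem_swap.2 (Or.inl hbg))
  rcases hF.swap_swap hB hf hg haf.2 hbB haf.1 hbg hab with h1 | ⟨h1, h2⟩
  · exact h a haf.2 b hbB h1
  · exact (h a haf.2 g hg h1).trans (hmin b hbB h2)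

/-- After the weight of `g` has been lowered, the best exchange for `g` settles the base again. -/
theorem Settled.swap_of_lower {F : Set (Finset E)} (hF : IsExchangeFamily F) {u v : E → ℝ≥0}
    {B : Finset E} (hB : B ∈ F) (huv : ∀ e, u e ≤ v e) {f g : E}
    (h : ∀ a ∈ B, ∀ b, b ∉ B → b ≠ g → swap B a b ∈ F → u a ≤ v b)
    (hf : f ∈ B) (hg : g ∉ B) (hgf : u g ≤ u f)
    (hmax : ∀ a ∈ B, swap B a g ∈ F → u a ≤ u f) :
    Settled F u v (swap B f g) := by
  intro a ha b hb hab
  have hbg : b ≠ g := fun hbg => hb (mem_swap.2 (Or.inl hbg))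
  by_cases hag : a = g
  · subst hag
    rw [swap_swap_self_left hg] at hab
    by_cases hbf : b = f
    · exact hbf ▸ hgf.trans (huv f)
    · exact hgf.trans (h f hf b (fun hbB => hb (mem_swap.2 (Or.inr ⟨hbf, hbB⟩))) hbg hab)
  have haf : a ≠ f ∧ a ∈ B := (mem_swap.1 ha).resolve_left hag
  by_cases hbf : b = f
  · subst hbf
    rw [swap_swap_self_right hf hg haf.1 haf.2] at hab
    exact (hmax a haf.2 hab).trans (huv b)
  have hbB : b ∉ B := fun hbB => hb (mem_swap.2 (Or.inr ⟨hbf, hbB⟩))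
  rcases hF.swap_swap hB hf hg haf.2 hbB haf.1 hbg hab with h1 | ⟨h1, h2⟩
  · exact h a haf.2 b hbB hbg h1
  · exact (hmax a haf.2 h1).trans (h f hf b hbB hbg h2)

theorem sum_swap (w : E → ℝ≥0) {B : Finset E} {a b : E} (ha : a ∈ B) (hb : b ∉ B) :
    ∑ e ∈ swap B a b, w e + w a = ∑ e ∈ B, w e + w b := by
  rw [swap, Finset.sum_insert (by simp [hb]), add_assoc, Finset.sum_erase_add _ _ ha, add_comm]

/-- For elements of equal weight in and out of the base, a locally optimal base is optimal. -/
theorem Settled.sum_le_sum {F : Set (Finset E)} (hF : IsExchangeFamily F) {w : E → ℝ≥0}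
    {B : Finset E} (hB : B ∈ F) (h : Settled F w w B) {T : Finset E} (hT : T ∈ F) :
    ∑ e ∈ B, w e ≤ ∑ e ∈ T, w e := by
  induction hk : (B \ T).card using Nat.strong_induction_on generalizing T with
  | _ k ih =>
  by_cases hBT : B \ T = ∅
  · exact Finset.sum_le_sum_of_subset (Finset.sdiff_eq_empty_iff_subset.1 hBT)
  -- The cheapest `x` of `B \ T` costs no more than any `y` in `T \ B`, so swapping `x` into `T`
  -- brings `T` closer to `B` without making it heavier.
  obtain ⟨x, hx, hxmin⟩ := Finset.exists_min_image (B \ T) w (Finset.nonempty_iff_ne_empty.2 hBT)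
  rw [Finset.mem_sdiff] at hx
  have hle : ∀ y ∈ T, y ∉ B → w x ≤ w y := by
    intro y hy hyB
    obtain ⟨a, ha, haT, hs⟩ := hF.rev_exchange B hB T hT y hy hyB
    exact (hxmin a (Finset.mem_sdiff.2 ⟨ha, haT⟩)).trans (h a ha y hyB hs)
  obtain ⟨y, hy, hyB, hs⟩ := hF.rev_exchange T hT B hB x hx.1 hx.2
  have hcard : (B \ swap T y x).card < k := by
    rw [← hk]
    refine Finset.card_lt_card ⟨fun c hc => ?_, fun hc => ?_⟩
    · simp only [Finset.mem_sdiff, mem_swap] at hc ⊢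
      grind
    · have := hc (Finset.mem_sdiff.2 hx)
      simp [mem_swap] at this
  have h1 := ih _ hcard hs rfl
  have h2 := sum_swap w hy hx.2
  have h3 := hle y hy hyB
  refine h1.trans (le_of_add_le_add_right (a := w y) ?_)
  rw [h2]
  gcongr

end Exchange

/-! ### Paths of bounded length -/

section Paths

variable {α : Type*}

/-- `b` can be reached from `a` in at most `k` steps of the relation `R`. -/
inductive ReachWithin (R : α → α → Prop) : ℕ → α → α → Prop
  | refl (k : ℕ) (a : α) : ReachWithin R k a a
  | head {k : ℕ} {a b c : α} : R a b → ReachWithin R k b c → ReachWithin R (k + 1) a c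

theorem ReachWithin.mono {R : α → α → Prop} {k l : ℕ} {a b : α} (h : ReachWithin R k a b)
    (hkl : k ≤ l) : ReachWithin R l a b := by
  induction h generalizing l with
  | refl k a => exact .refl l a
  | @head k a b c hab _ ih =>
    obtain ⟨l, rfl⟩ : ∃ l', l = l' + 1 := ⟨l - 1, by omega⟩
    exact .head hab (ih (by omega))

theorem ReachWithin.trans {R : α → α → Prop} {k l : ℕ} {a b c : α} (h : ReachWithin R k a b)
    (h' : ReachWithin R l b c) : ReachWithin R (k + l) a c := by
  induction h with
  | refl k a => exact h'.mono (by omega)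
  | head hab _ ih => exact (ReachWithin.head hab (ih h')).mono (by omega)

theorem ReachWithin.mono_rel {R R' : α → α → Prop} (hR : ∀ a b, R a b → R' a b) {k : ℕ} {a b : α}
    (h : ReachWithin R k a b) : ReachWithin R' k a b := by
  induction h with
  | refl k a => exact .refl k a
  | head hab _ ih => exact .head (hR _ _ hab) ih

theorem ReachWithin.exists_seq {R : α → α → Prop} {k : ℕ} {a b : α} (h : ReachWithin R k a b) :
    ∃ (l : ℕ) (σ : ℕ → α), l ≤ k ∧ σ 0 = a ∧ (∀ t < l, R (σ t) (σ (t + 1))) ∧ σ l = b := by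
  induction h with
  | refl k a => exact ⟨0, fun _ => a, by omega, rfl, by simp, rfl⟩
  | @head k a b c hab _ ih =>
    obtain ⟨l, σ, hl, h0, hs, hb⟩ := ih
    refine ⟨l + 1, fun t => Nat.casesOn t a σ, by omega, rfl, ?_, hb⟩
    rintro (_ | t) ht
    · simpa [h0] using hab
    · exact hs t (by omega)

end Paths

/-! ### Player-specific congestion games within one priority class -/

section ClassGame

variable {N : Type u} {E : Type v} [DecidableEq N] [DecidableEq E]

/-- The number of players in `C` that use `e`. -/
def load (C : Finset N) (S : N → Finset E) (e : E) : ℕ := (C.filter fun j => e ∈ S j).card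

theorem load_update {C : Finset N} {S : N → Finset E} {i : N} (hi : i ∈ C) (T : Finset E) (e : E) :
    load C (Function.update S i T) e + (if e ∈ S i then 1 else 0) =
      load C S e + (if e ∈ T then 1 else 0) := by
  simp only [load, Finset.card_filter]
  rw [← Finset.add_sum_erase _ _ hi, ← Finset.add_sum_erase C (fun j => if e ∈ S j then 1 else 0) hi]
  have : ∑ x ∈ C.erase i, (if e ∈ Function.update S i T x then 1 else 0) =
      ∑ x ∈ C.erase i, (if e ∈ S x then 1 else 0) :=
    Finset.sum_congr rfl fun x hx => by rw [Function.update_of_ne (Finset.ne_of_mem_erase hx)]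
  rw [this, Function.update_self]
  ring

theorem load_update_swap {C : Finset N} {S : N → Finset E} {i : N} (hi : i ∈ C) {a b : E}
    (ha : a ∈ S i) (hb : b ∉ S i) (e : E) :
    load C (Function.update S i (swap (S i) a b)) e + (if e = a then 1 else 0) =
      load C S e + (if e = b then 1 else 0) := by
  have h := load_update hi (swap (S i) a b) e (S := S)
  simp only [mem_swap] at h
  by_cases hea : e = a
  · subst hea
    have : e ≠ b := fun h => hb (h ▸ ha)
    simpa [ha, this] using h
  by_cases heb : e = b
  · subst heb
    simpa [hb, hea] using h
  by_cases he : e ∈ S i <;> simpa [he, hea, heb] using h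

/-- The cost of `i` in the game with player-specific delays `d` played by the players in `C`. -/
def classCost (C : Finset N) (d : N → E → ℕ → ℝ≥0) (S : N → Finset E) (i : N) : ℝ≥0 :=
  ∑ e ∈ S i, d i e (load C S e)

/-- A better response of a player in `C` to a strategy in her family `F i`. -/
def ClassBetterResponse (C : Finset N) (d : N → E → ℕ → ℝ≥0) (F : N → Set (Finset E))
    (S S' : N → Finset E) : Prop :=
  ∃ i ∈ C, ∃ T ∈ F i, S' = Function.update S i T ∧ classCost C d S' i < classCost C d S i

theorem classBetterResponse_swap {C : Finset N} {d : N → E → ℕ → ℝ≥0} {F : N → Set (Finset E)}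
    {S : N → Finset E} {i : N} (hi : i ∈ C) {a b : E} (ha : a ∈ S i) (hb : b ∉ S i)
    (hab : swap (S i) a b ∈ F i) (h : d i b (load C S b + 1) < d i a (load C S a)) :
    ClassBetterResponse C d F S (Function.update S i (swap (S i) a b)) := by
  refine ⟨i, hi, _, hab, rfl, ?_⟩
  have hne : a ≠ b := fun h => hb (h ▸ ha)
  -- With the delay after the move on `b` and the current delay elsewhere, both costs are sums of
  -- the same weight.
  let w : E → ℝ≥0 := Function.update (fun e => d i e (load C S e)) b (d i b (load C S b + 1))
  have h1 : classCost C d (Function.update S i (swap (S i) a b)) i =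
      ∑ e ∈ swap (S i) a b, w e := by
    rw [classCost, Function.update_self]
    refine Finset.sum_congr rfl fun e he => ?_
    have hl := load_update_swap hi ha hb e
    rcases mem_swap.1 he with rfl | ⟨hea, heS⟩
    · rw [if_neg hne.symm, if_pos rfl, add_zero] at hl
      simp only [w, Function.update_self]
      rw [hl]
    · have heb : e ≠ b := fun h => hb (h ▸ heS)
      rw [if_neg hea, if_neg heb, add_zero, add_zero] at hl
      simp only [w, Function.update_of_ne heb]
      rw [hl]
  have h2 : classCost C d S i = ∑ e ∈ S i, w e :=
    Finset.sum_congr rfl fun e he => by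
      have heb : e ≠ b := fun h => hb (h ▸ he)
      simp only [w, Function.update_of_ne heb]
  have h3 := sum_swap w ha hb
  have hwa : w a = d i a (load C S a) := Function.update_of_ne hne _ _
  have hwb : w b = d i b (load C S b + 1) := Function.update_self ..
  rw [h1, h2]
  refine lt_of_add_lt_add_right (a := w a) ?_
  rw [h3, hwa, hwb]
  gcongr

/-! ### The rank potential -/

section Potential

variable [Fintype E]

/-- The number of resources whose weight is smaller than that of `e`. -/
noncomputable def weightRank (w : E → ℝ≥0) (e : E) : ℕ := (Finset.univ.filter fun f => w f < w e).card

omit [DecidableEq E] in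
theorem weightRank_lt {w : E → ℝ≥0} {a b : E} (h : w b < w a) : weightRank w b < weightRank w a := by
  refine Finset.card_lt_card ⟨fun f hf => ?_, fun hc => ?_⟩
  · simp only [Finset.mem_filter, Finset.mem_univ, true_and] at hf ⊢
    exact hf.trans h
  · have : b ∈ Finset.univ.filter fun f => w f < w b := hc (by simpa using h)
    simp at this

/-- The total rank of the resources used by the players in `C`. -/
noncomputable def rankPotential (C : Finset N) (w : N → E → ℝ≥0) (S : N → Finset E) : ℕ :=
  ∑ i ∈ C, ∑ e ∈ S i, weightRank (w i) e

omit [DecidableEq N] [DecidableEq E] in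
theorem rankPotential_le (C : Finset N) (w : N → E → ℝ≥0) (S : N → Finset E) :
    rankPotential C w S ≤ C.card * (Fintype.card E * Fintype.card E) := by
  refine Finset.sum_le_card_nsmul _ _ _ fun i _ => ?_
  calc ∑ e ∈ S i, weightRank (w i) e ≤ (S i).card • Fintype.card E :=
        Finset.sum_le_card_nsmul _ _ _ fun e _ => Finset.card_le_univ _
    _ ≤ _ := by
        rw [smul_eq_mul]
        gcongr
        exact Finset.card_le_univ _

/-- The weights `w` do not depend on the profile, so only the term of `i` changes. -/
theorem rankPotential_swap_lt {C : Finset N} {w : N → E → ℝ≥0} {S : N → Finset E} {i : N}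
    (hi : i ∈ C) {a b : E} (ha : a ∈ S i) (hb : b ∉ S i) (h : w i b < w i a) :
    rankPotential C w (Function.update S i (swap (S i) a b)) < rankPotential C w S := by
  refine Finset.sum_lt_sum (fun j _ => ?_) ⟨i, hi, ?_⟩
  · by_cases hj : j = i
    · subst hj
      rw [Function.update_self, swap, Finset.sum_insert (by simp [hb]),
        ← Finset.add_sum_erase _ _ ha]
      have := weightRank_lt h
      omega
    · rw [Function.update_of_ne hj]
  · rw [Function.update_self, swap, Finset.sum_insert (by simp [hb]),
      ← Finset.add_sum_erase _ _ ha]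
    have := weightRank_lt h
    omega

end Potential

/-! ### Repairing a hole or an excess user -/

/-- Every player in `C` plays a strategy of her family that is settled for the loads `n`. -/
def SettledAt (C : Finset N) (d : N → E → ℕ → ℝ≥0) (F : N → Set (Finset E)) (n : E → ℕ)
    (S : N → Finset E) : Prop :=
  ∀ i ∈ C, S i ∈ F i ∧ Settled (F i) (fun e => d i e (n e)) (fun e => d i e (n e + 1)) (S i)

theorem SettledAt.update {C : Finset N} {d : N → E → ℕ → ℝ≥0} {F : N → Set (Finset E)} {n : E → ℕ}
    {S : N → Finset E} (h : SettledAt C d F n S) {i : N} {T : Finset E} (hT : T ∈ F i)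
    (hs : Settled (F i) (fun e => d i e (n e)) (fun e => d i e (n e + 1)) T) :
    SettledAt C d F n (Function.update S i T) := by
  intro j hj
  by_cases hji : j = i
  · subst hji
    rw [Function.update_self]
    exact ⟨hT, hs⟩
  · rw [Function.update_of_ne hji]
    exact h j hj

variable {C : Finset N} {d : N → E → ℕ → ℝ≥0} {F : N → Set (Finset E)}

/-- If all players are settled for the loads obtained by adding a phantom user to `h`, then
better responses that move the hole lead to an equilibrium. -/
theorem reach_of_hole [Fintype E] (hd : ∀ i e, Monotone (d i e))
    (hF : ∀ i ∈ C, IsExchangeFamily (F i)) (n : E → ℕ) (k : ℕ) (S : N → Finset E) (h : E)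
    (hk : rankPotential C (fun i e => d i e (n e)) S ≤ k)
    (hn : ∀ e, load C S e + (if e = h then 1 else 0) = n e) (hS : SettledAt C d F n S) :
    ∃ S', ReachWithin (ClassBetterResponse C d F) k S S' ∧ SettledAt C d F (load C S') S' := by
  classical
  induction k using Nat.strong_induction_on generalizing S h with
  | _ k ih =>
  by_cases hex : ∃ i ∈ C, h ∉ S i ∧ ∃ a ∈ S i, swap (S i) a h ∈ F i ∧ d i h (n h) < d i a (n a)
  · obtain ⟨i, hi, hhi, a', ha', hsw', hlt'⟩ := hex
    obtain ⟨a, ha, hmax⟩ := Finset.exists_max_image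
      ((S i).filter fun a => swap (S i) a h ∈ F i) (fun a => d i a (n a))
      ⟨a', Finset.mem_filter.2 ⟨ha', hsw'⟩⟩
    rw [Finset.mem_filter] at ha
    have hlt : d i h (n h) < d i a (n a) :=
      hlt'.trans_le (hmax a' (Finset.mem_filter.2 ⟨ha', hsw'⟩))
    have hah : a ≠ h := fun h => hhi (h ▸ ha.1)
    have hna : load C S a = n a := by simpa [hah] using hn a
    have hnh : load C S h + 1 = n h := by simpa using hn h
    have hpot := rankPotential_swap_lt (w := fun i e => d i e (n e)) hi ha.1 hhi hlt
    obtain ⟨S', hr, hS'⟩ := ih (k - 1) (by omega) (Function.update S i (swap (S i) a h)) a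
      (by omega)
      (fun e => by rw [load_update_swap hi ha.1 hhi, hn])
      (hS.update ha.2 (Settled.swap_of_lower (hF i hi) (hS i hi).1 (fun e => hd i e (Nat.le_succ _))
        (fun a ha b hb _ hab => (hS i hi).2 a ha b hb hab) ha.1 hhi hlt.le
        fun a ha hs => hmax a (Finset.mem_filter.2 ⟨ha, hs⟩)))
    refine ⟨S', (ReachWithin.head (classBetterResponse_swap hi ha.1 hhi ha.2 ?_) hr).mono
      (by omega), hS'⟩
    rwa [hnh, hna]
  · refine ⟨S, .refl _ _, fun i hi => ⟨(hS i hi).1, fun a ha b hb hab => ?_⟩⟩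
    have hna : load C S a ≤ n a := by
      rw [← hn a]
      exact Nat.le_add_right _ _
    refine (hd i a hna).trans ?_
    -- Entering the hole costs the delay at `n h`, not at `n h + 1`, so settledness for `n` says
    -- nothing here; the failure of `hex` does.
    by_cases hbh : b = h
    · subst hbh
      have hnb : load C S b + 1 = n b := by simpa using hn b
      simp only [hnb]
      by_contra hc
      exact hex ⟨i, hi, hb, a, ha, hab, not_le.1 hc⟩
    · have hnb : load C S b = n b := by simpa [hbh] using hn b
      simp only [hnb]
      exact (hS i hi).2 a ha b hb hab

/-- If all players are settled for the loads obtained by moving one user from `x` to `g`, then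
better responses that move the excess user lead to an equilibrium. -/
theorem reach_of_excess [Fintype E] (hd : ∀ i e, Monotone (d i e))
    (hF : ∀ i ∈ C, IsExchangeFamily (F i)) (n : E → ℕ) (g : E) (k : ℕ) (S : N → Finset E) (x : E)
    (hk : rankPotential C (fun i e => d i e (n e + 1)) S ≤ k)
    (hn : ∀ e, load C S e + (if e = g then 1 else 0) = n e + (if e = x then 1 else 0))
    (hS : SettledAt C d F n S) :
    ∃ S', ReachWithin (ClassBetterResponse C d F) (k + C.card * (Fintype.card E * Fintype.card E))
      S S' ∧ SettledAt C d F (load C S') S' := by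
  classical
  induction k using Nat.strong_induction_on generalizing S x with
  | _ k ih =>
  by_cases hxg : x = g
  · subst hxg
    have : load C S = n := funext fun e => Nat.add_right_cancel (hn e)
    exact ⟨S, .refl _ _, by rwa [this]⟩
  by_cases hex : ∃ i ∈ C, x ∈ S i ∧ ∃ b, b ∉ S i ∧ swap (S i) x b ∈ F i ∧
      d i b (n b + 1) < d i x (n x + 1)
  · obtain ⟨i, hi, hxi, b', hb', hsw', hlt'⟩ := hex
    obtain ⟨b, hb, hmin⟩ := Finset.exists_min_image
      (Finset.univ.filter fun b => b ∉ S i ∧ swap (S i) x b ∈ F i) (fun b => d i b (n b + 1))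
      ⟨b', by simp [hb', hsw']⟩
    simp only [Finset.mem_filter, Finset.mem_univ, true_and] at hb hmin
    have hlt : d i b (n b + 1) < d i x (n x + 1) := (hmin b' ⟨hb', hsw'⟩).trans_lt hlt'
    have hbx : b ≠ x := fun h => hb.1 (h ▸ hxi)
    -- Only an inequality: if `b` is the hole `g`, the real load is one below `n`, which makes the
    -- move even better.
    have hnb : load C S b ≤ n b := by
      have := hn b
      rw [if_neg hbx] at this
      omega
    have hnx : load C S x = n x + 1 := by simpa [hxg] using hn x
    have hpot := rankPotential_swap_lt (w := fun i e => d i e (n e + 1)) hi hxi hb.1 hlt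
    obtain ⟨S', hr, hS'⟩ := ih (k - 1) (by omega) (Function.update S i (swap (S i) x b)) b
      (by omega)
      (fun e => by
        have h1 := load_update_swap hi hxi hb.1 e
        have h2 := hn e
        omega)
      (hS.update hb.2 (Settled.swap_of_raise (hF i hi) (hS i hi).1 (hS i hi).2
        (fun e => hd i e (Nat.le_succ _)) hxi hb.1 hlt.le (fun b h1 h2 => hmin b ⟨h1, h2⟩) hb.2))
    refine ⟨S', (ReachWithin.head (classBetterResponse_swap hi hxi hb.1 hb.2 ?_) hr).mono
      (by omega), hS'⟩
    rw [hnx]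
    exact (hd i b (Nat.succ_le_succ hnb)).trans_lt hlt
  -- Nobody wants to leave `x`, so its excess user is absorbed into the reference loads and only the
  -- hole at `g` remains. The weights change, so the potential is bounded afresh.
  · obtain ⟨S', hr, hS'⟩ := reach_of_hole hd hF (fun e => n e + if e = x then 1 else 0) _ S g
      (rankPotential_le _ _ _) hn (by
        refine fun i hi => ⟨(hS i hi).1, fun a ha b hb hab => ?_⟩
        have hvb : d i b (n b + 1) ≤ d i b (n b + (if b = x then 1 else 0) + 1) :=
          hd i b (by omega)
        refine le_trans ?_ hvb
        by_cases hax : a = x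
        · subst hax
          simp only [if_true]
          by_contra hc
          exact hex ⟨i, hi, ha, b, hb, hab, not_le.1 hc⟩
        · simp only [if_neg hax, add_zero]
          exact (hS i hi).2 a ha b hb hab)
    exact ⟨S', hr.mono (by omega), hS'⟩

/-- One more resource `f` becomes available to player `i`. -/
theorem reach_of_new_resource [Fintype E] (hd : ∀ i e, Monotone (d i e))
    (hF : ∀ i ∈ C, IsExchangeFamily (F i)) (S : N → Finset E) (i : N) (hi : i ∈ C) (f : E)
    (hSF : ∀ j ∈ C, S j ∈ F j)
    (hS : ∀ j ∈ C, ∀ a ∈ S j, ∀ b, b ∉ S j → (j = i → b ≠ f) → swap (S j) a b ∈ F j →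
      d j a (load C S a) ≤ d j b (load C S b + 1)) :
    ∃ S', ReachWithin (ClassBetterResponse C d F)
      (1 + 2 * (C.card * (Fintype.card E * Fintype.card E))) S S' ∧
      SettledAt C d F (load C S') S' := by
  classical
  by_cases hex : f ∉ S i ∧ ∃ a ∈ S i, swap (S i) a f ∈ F i ∧
      d i f (load C S f + 1) < d i a (load C S a)
  · obtain ⟨hfi, a', ha', hsw', hlt'⟩ := hex
    obtain ⟨a, ha, hmax⟩ := Finset.exists_max_image
      ((S i).filter fun a => swap (S i) a f ∈ F i) (fun a => d i a (load C S a))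
      ⟨a', Finset.mem_filter.2 ⟨ha', hsw'⟩⟩
    rw [Finset.mem_filter] at ha
    have hlt : d i f (load C S f + 1) < d i a (load C S a) :=
      hlt'.trans_le (hmax a' (Finset.mem_filter.2 ⟨ha', hsw'⟩))
    -- The loads before the move serve as reference: now `f` has one user too many and `a` one too
    -- few.
    obtain ⟨S', hr, hS'⟩ := reach_of_excess hd hF (load C S) a _
      (Function.update S i (swap (S i) a f)) f (rankPotential_le _ _ _)
      (load_update_swap hi ha.1 hfi) (by
        intro j hj
        by_cases hji : j = i
        · subst hji
          rw [Function.update_self]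
          exact ⟨ha.2, Settled.swap_of_lower (hF j hj) (hSF j hj) (fun e => hd j e (Nat.le_succ _))
            (fun a ha b hb hbf hab => hS j hj a ha b hb (fun _ => hbf) hab) ha.1 hfi
            ((hd j f (Nat.le_succ _)).trans hlt.le)
            fun a ha hs => hmax a (Finset.mem_filter.2 ⟨ha, hs⟩)⟩
        · rw [Function.update_of_ne hji]
          exact ⟨hSF j hj, fun a ha b hb hab => hS j hj a ha b hb (fun h => absurd h hji) hab⟩)
    exact ⟨S', (ReachWithin.head (classBetterResponse_swap hi ha.1 hfi ha.2 hlt) hr).mono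
      (by omega), hS'⟩
  · refine ⟨S, .refl _ _, fun j hj => ⟨hSF j hj, fun a ha b hb hab => ?_⟩⟩
    by_cases hjb : j = i ∧ b = f
    · obtain ⟨rfl, rfl⟩ := hjb
      by_contra hc
      exact hex ⟨hb, a, ha, hab, not_le.1 hc⟩
    · exact hS j hj a ha b hb (fun h1 h2 => hjb ⟨h1, h2⟩) hab

/-- The strategies of `i` that use only resources of `S i` and resources made available by `Z`. -/
def available (F : N → Set (Finset E)) (S : N → Finset E) (Z : Finset (N × E)) (i : N) :
    Set (Finset E) :=
  {B ∈ F i | ∀ e ∈ B, e ∈ S i ∨ (i, e) ∈ Z}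

/-- Induction on `Z`: for empty `Z` no exchange is available, and each new pair costs one call of
`reach_of_new_resource`. -/
theorem reach_available [Fintype E] (hd : ∀ i e, Monotone (d i e))
    (hF : ∀ i ∈ C, IsExchangeFamily (F i)) (S : N → Finset E) (hS : ∀ i ∈ C, S i ∈ F i)
    (Z : Finset (N × E)) (hZ : ∀ z ∈ Z, z.1 ∈ C) :
    ∃ S', ReachWithin (ClassBetterResponse C d F)
      (Z.card * (1 + 2 * (C.card * (Fintype.card E * Fintype.card E)))) S S' ∧
      SettledAt C d (available F S Z) (load C S') S' := by
  induction Z using Finset.induction_on with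
  | empty =>
    refine ⟨S, .refl _ _, fun i hi => ⟨⟨hS i hi, fun e he => Or.inl he⟩, fun a _ b hb hab => ?_⟩⟩
    have := hab.2 b (mem_swap.2 (Or.inl rfl))
    simp [hb] at this
  | insert z Z hz ih =>
    obtain ⟨S₁, hr₁, hS₁⟩ := ih fun z' hz' => hZ z' (Finset.mem_insert_of_mem hz')
    obtain ⟨S₂, hr₂, hS₂⟩ := reach_of_new_resource (F := available F S (insert z Z)) hd
      (fun i hi => (hF i hi).restrict _) S₁ z.1 (hZ z (Finset.mem_insert_self _ _)) z.2
      (fun j hj => ⟨(hS₁ j hj).1.1, fun e he => ((hS₁ j hj).1.2 e he).imp_right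
        fun h => Finset.mem_insert_of_mem h⟩)
      (fun j hj a ha b hb hjb hab => (hS₁ j hj).2 a ha b hb ⟨hab.1, fun e he => by
        rcases mem_swap.1 he with rfl | he'
        · refine (hab.2 e he).imp_right fun h => ?_
          rcases Finset.mem_insert.1 h with rfl | h
          · exact absurd rfl (hjb rfl)
          · exact h
        · exact (hS₁ j hj).1.2 e he'.2⟩)
    refine ⟨S₂, (hr₁.trans (hr₂.mono_rel ?_)).mono ?_, hS₂⟩
    · rintro A B ⟨i, hi, T, hT, h⟩
      exact ⟨i, hi, T, hT.1, h⟩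
    · rw [Finset.card_insert_of_notMem hz, add_one_mul]

/-- A deviating player faces fixed weights: the current load on resources she uses, one more on the
others. Settledness is local optimality for these weights, hence global optimality. -/
theorem classCost_le_of_settledAt (hF : ∀ i ∈ C, IsExchangeFamily (F i)) {S : N → Finset E}
    (hS : SettledAt C d F (load C S) S) {i : N} (hi : i ∈ C) {T : Finset E} (hT : T ∈ F i) :
    classCost C d S i ≤ classCost C d (Function.update S i T) i := by
  have h : Settled (F i) (fun e => d i e (load C S e + if e ∈ S i then 0 else 1))
      (fun e => d i e (load C S e + if e ∈ S i then 0 else 1)) (S i) := by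
    intro a ha b hb hab
    simpa [ha, hb] using (hS i hi).2 a ha b hb hab
  have h1 := h.sum_le_sum (hF i hi) (hS i hi).1 hT
  refine (le_of_eq (Finset.sum_congr rfl fun e he => ?_)).trans (h1.trans (le_of_eq ?_))
  · simp [he]
  · rw [classCost, Function.update_self]
    refine Finset.sum_congr rfl fun e he => ?_
    have := load_update hi T e (S := S)
    rw [if_pos he] at this
    congr 1
    split_ifs at this ⊢ <;> omega

/-- A player-specific congestion game on exchange families reaches an equilibrium by polynomially
many better responses. -/
theorem reach_class_equilibrium [Fintype E] (hd : ∀ i e, Monotone (d i e))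
    (hF : ∀ i ∈ C, IsExchangeFamily (F i)) (S : N → Finset E) (hS : ∀ i ∈ C, S i ∈ F i) :
    ∃ S', ReachWithin (ClassBetterResponse C d F)
      (C.card * (Fintype.card E * (1 + 2 * (C.card * (Fintype.card E * Fintype.card E))))) S S' ∧
      ∀ i ∈ C, ∀ T ∈ F i, classCost C d S' i ≤ classCost C d (Function.update S' i T) i := by
  obtain ⟨S', hr, hS'⟩ := reach_available hd hF S hS (C ×ˢ Finset.univ)
    fun z hz => (Finset.mem_product.1 hz).1
  have hS'' : SettledAt C d F (load C S') S' := fun i hi => ⟨(hS' i hi).1.1,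
    fun a ha b hb hab => (hS' i hi).2 a ha b hb ⟨hab, fun e _ => Or.inr (by simp [hi])⟩⟩
  refine ⟨S', hr.mono ?_, fun i hi T hT => classCost_le_of_settledAt hF hS'' hi hT⟩
  rw [Finset.card_product, Finset.card_univ, mul_assoc]

end ClassGame

/-! ### From priority classes to the whole game -/

namespace PriorityCongestionGame

variable {N : Type u} {E : Type v} [Fintype N] [DecidableEq E]
  (G : PriorityCongestionGame N E)

/-- The cost of a player depends only on the players that do not have lower priority. -/
theorem cost_congr {p : N → ℕ+} (hp : ∀ e, G.priority e = p) {S S' : N → Finset E} {i : N}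
    (h : ∀ j, p j ≤ p i → S j = S' j) : G.cost S i = G.cost S' i := by
  rw [cost, cost, h i le_rfl]
  refine Finset.sum_congr rfl fun e _ => ?_
  have h1 : G.numHigher S i e = G.numHigher S' i e := by
    rw [numHigher, numHigher]
    congr 1
    refine Finset.filter_congr fun j _ => ?_
    rw [hp]
    exact and_congr_left fun hj => by rw [h j hj.le]
  have h2 : G.numEqual S i e = G.numEqual S' i e := by
    rw [numEqual, numEqual]
    congr 1
    refine Finset.filter_congr fun j _ => ?_
    rw [hp]
    exact and_congr_left fun hj => by rw [h j hj.le]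
  rw [h1, h2]

/-- The delays in the game played by the players of priority `q` when the players of higher priority
are fixed as in `S`. -/
def classDelay (p : N → ℕ+) (q : ℕ+) (S : N → Finset E) (i : N) (e : E) (k : ℕ) : ℝ≥0 :=
  -- Delays are constrained only for at least one user; reusing the value at 1 for `k = 0` gives
  -- monotonicity on all of `ℕ`.
  G.delay i e (Finset.univ.filter fun j => e ∈ S j ∧ p j < q).card (max k 1)

theorem classDelay_mono (p : N → ℕ+) (q : ℕ+) (S : N → Finset E) (i : N) (e : E) :
    Monotone (G.classDelay p q S i e) := by
  intro k l hkl
  rcases (max_le_max_right 1 hkl).eq_or_lt with h | h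
  · rw [classDelay, classDelay, h]
  · exact G.delay_mono_right i e _ _ _ (le_max_right _ _) h

variable [DecidableEq N]

omit [DecidableEq N] in
theorem cost_eq_classCost {p : N → ℕ+} (hp : ∀ e, G.priority e = p) {q : ℕ+} {S S' : N → Finset E}
    (h : ∀ j, p j < q → S' j = S j) {i : N} (hi : p i = q) :
    G.cost S' i = classCost (Finset.univ.filter fun j => p j = q) (G.classDelay p q S) S' i := by
  refine Finset.sum_congr rfl fun e he => ?_
  have h1 : G.numHigher S' i e = (Finset.univ.filter fun j => e ∈ S j ∧ p j < q).card := by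
    rw [numHigher]
    congr 1
    refine Finset.filter_congr fun j _ => ?_
    rw [hp, hi]
    exact and_congr_left fun hj => by rw [h j hj]
  have h2 : G.numEqual S' i e = load (Finset.univ.filter fun j => p j = q) S' e := by
    rw [numEqual, load, Finset.filter_filter]
    congr 1
    refine Finset.filter_congr fun j _ => ?_
    rw [hp, hi, and_comm]
  have h3 : 1 ≤ load (Finset.univ.filter fun j => p j = q) S' e :=
    Finset.card_pos.2 ⟨i, by simp [hi, he]⟩
  rw [classDelay, h1, h2, max_eq_left h3]

/-- Only players of priority `q` move, so the class delays computed from `S` stay correct along the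
path. -/
theorem reach_of_class_reach {p : N → ℕ+} (hp : ∀ e, G.priority e = p) {q : ℕ+}
    {S A B : N → Finset E} {k : ℕ}
    (hr : ReachWithin (ClassBetterResponse (Finset.univ.filter fun j => p j = q)
      (G.classDelay p q S) G.strategies) k A B) (hA : ∀ j, p j < q → A j = S j)
    (hprof : G.IsProfile A) :
    ReachWithin G.IsBetterResponse k A B ∧ (∀ j, p j < q → B j = S j) ∧ G.IsProfile B := by
  induction hr with
  | refl k a => exact ⟨.refl _ _, hA, hprof⟩
  | @head k a b c hab _ ih =>
    obtain ⟨i, hi, T, hT, rfl, hlt⟩ := hab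
    replace hi : p i = q := by simpa using hi
    have hb : ∀ j, p j < q → Function.update a i T j = S j := fun j hj => by
      rw [Function.update_of_ne (fun h => by rw [h, hi] at hj; exact lt_irrefl _ hj), hA j hj]
    have hprof' : G.IsProfile (Function.update a i T) := fun j => by
      by_cases hji : j = i
      · subst hji
        rwa [Function.update_self]
      · rw [Function.update_of_ne hji]
        exact hprof j
    obtain ⟨h1, h2⟩ := ih hb hprof'
    refine ⟨.head ⟨i, T, hT, rfl, ?_⟩ h1, h2⟩
    rwa [G.cost_eq_classCost hp hb hi, G.cost_eq_classCost hp hA hi]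

omit [Fintype N] [DecidableEq N] in
theorem IsMatroidGame.isExchangeFamily {G : PriorityCongestionGame N E} (hG : G.IsMatroidGame)
    (i : N) : IsExchangeFamily (G.strategies i) := by
  obtain ⟨M, -, hM⟩ := hG i
  have : G.strategies i = {B : Finset E | M.IsBase (B : Set E)} := Set.ext hM
  rw [this]
  exact M.isExchangeFamily_bases

/-- The players of priority smaller than `m` can be brought to equilibrium. -/
theorem reach_equilibrium_below [Fintype E] {p : N → ℕ+} (hp : ∀ e, G.priority e = p)
    (hG : G.IsMatroidGame) (S : N → Finset E) (hS : G.IsProfile S) (m : ℕ) :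
    ∃ S', ReachWithin G.IsBetterResponse ((Finset.univ.filter fun i => (p i : ℕ) < m).card *
        (Fintype.card E * (1 + 2 * (Fintype.card N * (Fintype.card E * Fintype.card E))))) S S' ∧
      G.IsProfile S' ∧ ∀ i, (p i : ℕ) < m → ∀ T ∈ G.strategies i,
        G.cost S' i ≤ G.cost (Function.update S' i T) i := by
  induction m with
  | zero => exact ⟨S, .refl _ _, hS, fun i hi => absurd hi (Nat.not_lt_zero _)⟩
  | succ m ih =>
    obtain ⟨S₁, hr₁, hS₁, heq₁⟩ := ih
    rcases Nat.eq_zero_or_pos m with rfl | hm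
    · refine ⟨S₁, hr₁.mono (by simp), hS₁, fun i hi => ?_⟩
      have := (p i).pos
      omega
    obtain ⟨q, rfl⟩ : ∃ q : ℕ+, m = q := ⟨⟨m, hm⟩, rfl⟩
    obtain ⟨S₂, hr, heq⟩ := reach_class_equilibrium (C := Finset.univ.filter fun j => p j = q)
      (d := G.classDelay p q S₁) (F := G.strategies) (G.classDelay_mono p q S₁)
      (fun i _ => hG.isExchangeFamily i) S₁ (fun i _ => hS₁ i)
    obtain ⟨hr₂, hagree, hS₂⟩ := G.reach_of_class_reach hp hr (fun _ _ => rfl) hS₁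
    refine ⟨S₂, (hr₁.trans hr₂).mono ?_, hS₂, fun i hi T hT => ?_⟩
    -- The class sizes add up, so the number of classes does not enter the bound.
    · have hcard : (Finset.univ.filter fun i => (p i : ℕ) < (q : ℕ) + 1).card =
          (Finset.univ.filter fun i => (p i : ℕ) < q).card +
            (Finset.univ.filter fun i => p i = q).card := by
        rw [← Finset.card_union_of_disjoint]
        · congr 1
          ext i
          simp only [Finset.mem_filter, Finset.mem_univ, true_and, Finset.mem_union,
            ← PNat.coe_inj]
          omega
        · refine Finset.disjoint_filter.2 fun i _ h1 h2 => ?_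
          rw [h2] at h1
          exact lt_irrefl _ h1
      rw [hcard, add_mul]
      gcongr
      exact Finset.card_le_univ _
    · rcases Nat.lt_succ_iff_lt_or_eq.1 hi with hlt | hiq
      · have hle : ∀ j, p j ≤ p i → S₂ j = S₁ j := fun j hj =>
          hagree j (lt_of_le_of_lt hj (PNat.coe_lt_coe _ _ |>.1 hlt))
        rw [G.cost_congr hp hle, G.cost_congr hp (S := Function.update S₂ i T)
          (S' := Function.update S₁ i T) fun j hj => ?_]
        · exact heq₁ i hlt T hT
        · by_cases hji : j = i
          · subst hji
            simp
          · rw [Function.update_of_ne hji, Function.update_of_ne hji, hle j hj]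
      · have hiq' : p i = q := PNat.coe_inj.1 hiq
        have hupd : ∀ j, p j < q → Function.update S₂ i T j = S₁ j := fun j hj => by
          rw [Function.update_of_ne (fun h => by rw [h, hiq'] at hj; exact lt_irrefl _ hj),
            hagree j hj]
        rw [G.cost_eq_classCost hp hagree hiq', G.cost_eq_classCost hp hupd hiq']
        exact heq i (by simp [hiq']) T hT

end PriorityCongestionGame

theorem mainTheorem7 :
    ∃ P : MvPolynomial (Fin 2) ℕ,
      ∀ (N : Type u) (E : Type v) [Fintype N] [DecidableEq N] [Fintype E] [DecidableEq E]
        (G : PriorityCongestionGame N E),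
        G.Consistent → G.IsMatroidGame →
        ∀ S : N → Finset E, G.IsProfile S →
          ∃ (k : ℕ) (σ : ℕ → N → Finset E),
            k ≤ MvPolynomial.eval ![Fintype.card N, Fintype.card E] P ∧
            σ 0 = S ∧
            (∀ t < k, G.IsBetterResponse (σ t) (σ (t + 1))) ∧
            G.IsPureNash (σ k) := by
  refine ⟨MvPolynomial.X 0 * (MvPolynomial.X 1 *
    (1 + 2 * (MvPolynomial.X 0 * (MvPolynomial.X 1 * MvPolynomial.X 1)))), ?_⟩
  intro N E _ _ _ _ G ⟨p, hp⟩ hG S hS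
  -- A bound above the largest priority covers all players.
  obtain ⟨S', hr, hS', heq⟩ := G.reach_equilibrium_below hp hG S hS
    (Finset.univ.sup (fun i => (p i : ℕ)) + 1)
  obtain ⟨k, σ, hk, h0, hstep, hend⟩ := hr.exists_seq
  refine ⟨k, σ, hk.trans ?_, h0, hstep, ?_⟩
  · simp only [map_mul, map_add, map_one, map_ofNat, MvPolynomial.eval_X, Matrix.cons_val_zero,
      Matrix.cons_val_one]
    gcongr
    exact Finset.card_le_univ _
  · rw [hend]
    exact ⟨hS', fun i => heq i (Nat.lt_succ_of_le (Finset.le_sup (f := fun i => (p i : ℕ))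
      (Finset.mem_univ i)))⟩
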